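/- Let $n\ge 1$ and $\alpha\in(0,1)$. For $t>0$ and $x,y\in\mathbb R^n$ let $$P_t(x,y)=\frac1{2\pi^{(n+1)/2}}\int_0^\infty \frac{t}{s^{3/2}}\,e^{-t^2/(4s)}\,\frac{\exp\left(-\frac{|y-e^{-s}x|^2}{1-e^{-2s}}\right)}{(1-e^{-2s})^{n/2}}\,ds$$ be the Ornstein–Uhlenbeck Poisson kernel, and let $P_tf(x)=\int_{\mathbb R^n}P_t(x,y)f(y)\,dy$. A measurable function $f:\mathbb R^n\to\mathbb R$ belongs to the global Gaussian Lipschitz space $\mathrm{GGLip}_\alpha$ if $$\int_{\mathbb R^n}\frac{e^{-|y|^2}}{\sqrt{\ln(e+|y|)}}\,|f(y)|\,dy<\infty$$ and there is $A>0$ such that for all $t>0$ the integral $P_tf(x)$ converges absolutely and is differentiable in $t$ for every $x$, with $\|t\,\partial_tP_tf\|_{L^\infty(\mathbb R^n)}\le A\,t^\alpha$. For $x,y\in\mathbb R^n$ write $y=y_x+y_x'$ with $y_x$ parallel and $y_x'$ orthogonal to $x$ (with $y_x=y$, $y_x'=0$ if $x=0$), and let $$d(x,y_x)=\big|\ln(1+|x|)-\mathrm{sgn}\langle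 x,y\rangle\,\ln(1+|y_x|)\big|,\qquad \mathrm{sgn}\,0=1.$$ A function $g:\mathbb R^n\to\mathbb R$ is said to satisfy the condition $(\mathrm L_\alpha)$ if there is $K>0$ such that $$|g(x)-g(y)|\le K\min\left\{|x-y|^\alpha,\ d(x,y_x)^{\alpha/2}+|y_x'|^\alpha\right\},\qquad x,y\in\mathbb R^n .$$ Then the function $f(x)=[\ln(e+|x|)]^{\alpha/2}$, $x\in\mathbb R^n$, belongs to $\mathrm{GGLip}_\alpha$ and satisfies $(\mathrm L_\alpha)$. Every $g$ satisfying $(\mathrm L_\alpha)$ has the growth $g(x)=O\big((\ln|x|)^{\alpha/2}\big)$ as $|x|\to\infty$, and this bound is sharp: $f(x)\sim(\ln|x|)^{\alpha/2}$ as $|x|\to\infty$, and consequently, if $\varphi:\mathbb R^n\to\mathbb R$ is such that $g=O(\varphi)$ as $|x|\to\infty$ for every $g$ satisfying $(\mathrm L_\alpha)$, then $(\ln|x|)^{\alpha/2}=O(\varphi(x))$ as $|x|\to\infty$. -/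

import Mathlib

open MeasureTheory Filter Asymptotics

noncomputable section

namespace GaussLip

/-- The Mehler kernel `M_r(x, y) = (1 - r²)^{-n/2} exp(-|y - r x|² / (1 - r²))`, for `0 < r < 1`. -/
def mehlerKernel {n : ℕ} (r : ℝ) (x y : EuclideanSpace ℝ (Fin n)) : ℝ :=
  Real.exp (-(‖y - r • x‖ ^ 2 / (1 - r ^ 2))) / (1 - r ^ 2) ^ ((n : ℝ) / 2)

/-- The Ornstein-Uhlenbeck Poisson kernel `P_t(x, y)`, for `t > 0`, obtained from the Mehler kernel
by subordination. -/
def poissonKernel {n : ℕ} (t : ℝ) (x y : EuclideanSpace ℝ (Fin n)) : ℝ :=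
  1 / (2 * Real.pi ^ (((n : ℝ) + 1) / 2)) *
    ∫ s in Set.Ioi (0 : ℝ),
      t / s ^ ((3 : ℝ) / 2) * Real.exp (-(t ^ 2 / (4 * s))) * mehlerKernel (Real.exp (-s)) x y

/-- The Gaussian Poisson integral `P_t f(x) = ∫ P_t(x, y) f(y) dy` (Lebesgue measure). -/
def poissonIntegral {n : ℕ} (t : ℝ) (f : EuclideanSpace ℝ (Fin n) → ℝ)
    (x : EuclideanSpace ℝ (Fin n)) : ℝ :=
  ∫ y, poissonKernel t x y * f y

/-- The growth condition `∫ e^{-|y|²} (ln(e + |y|))^{-1/2} |f(y)| dy < ∞`. -/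
def GrowthCondition {n : ℕ} (f : EuclideanSpace ℝ (Fin n) → ℝ) : Prop :=
  Integrable (fun y : EuclideanSpace ℝ (Fin n) =>
    Real.exp (-‖y‖ ^ 2) / √(Real.log (Real.exp 1 + ‖y‖)) * |f y|)

/-- The condition `‖t ∂_t P_t f‖_{L^∞} ≤ A t^α` for all `t > 0`; the first part says that `P_t f(x)`
and its `t`-derivative really exist, so that no default value enters the norm. -/
def PoissonLipBound {n : ℕ} (α A : ℝ) (f : EuclideanSpace ℝ (Fin n) → ℝ) : Prop :=
  ∀ t : ℝ, 0 < t →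
    (∀ x, Integrable (fun y => poissonKernel t x y * f y) ∧
      DifferentiableAt ℝ (fun τ : ℝ => poissonIntegral τ f x) t) ∧
    eLpNorm (fun x => t * deriv (fun τ : ℝ => poissonIntegral τ f x) t) ⊤ volume
      ≤ ENNReal.ofReal (A * t ^ α)

/-- Membership in the global Gaussian Lipschitz space `GGLip_α`. -/
def MemGGLip {n : ℕ} (α : ℝ) (f : EuclideanSpace ℝ (Fin n) → ℝ) : Prop :=
  AEMeasurable f ∧ GrowthCondition f ∧ ∃ A : ℝ, 0 < A ∧ PoissonLipBound α A f

/-- The component `y_x` of `y` parallel to `x`, with `y_x = y` if `x = 0`. (In dimension one the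
formula for `x ≠ 0` gives `y` as well.) -/
def par {n : ℕ} (x y : EuclideanSpace ℝ (Fin n)) : EuclideanSpace ℝ (Fin n) :=
  if x = 0 then y else (inner ℝ x y / ‖x‖ ^ 2) • x

/-- The component `y_x' = y - y_x` of `y` orthogonal to `x`. -/
def perp {n : ℕ} (x y : EuclideanSpace ℝ (Fin n)) : EuclideanSpace ℝ (Fin n) :=
  y - par x y

/-- The sign of a real number, with the convention `sgn 0 = 1`. -/
def sgn (a : ℝ) : ℝ := if a < 0 then -1 else 1

/-- `d(x, y_x) = |ln(1 + |x|) - sgn⟨x, y⟩ ln(1 + |y_x|)|`, as a function of `x` and `y`. -/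
def dPar {n : ℕ} (x y : EuclideanSpace ℝ (Fin n)) : ℝ :=
  |Real.log (1 + ‖x‖) - sgn (inner ℝ x y) * Real.log (1 + ‖par x y‖)|

/-- The Lipschitz-type condition
`|f(x) - f(y)| ≤ K min {|x - y|^α, d(x, y_x)^{α/2} + |y_x'|^α}` for all `x, y`. -/
def LipCondition {n : ℕ} (α : ℝ) (f : EuclideanSpace ℝ (Fin n) → ℝ) : Prop :=
  ∃ K : ℝ, 0 < K ∧ ∀ x y : EuclideanSpace ℝ (Fin n),
    |f x - f y| ≤ K * min (‖x - y‖ ^ α) (dPar x y ^ (α / 2) + ‖perp x y‖ ^ α)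

/-- The function `f(x) = [ln(e + |x|)]^{α/2}`. -/
def logExample (n : ℕ) (α : ℝ) (x : EuclideanSpace ℝ (Fin n)) : ℝ :=
  Real.log (Real.exp 1 + ‖x‖) ^ (α / 2)

/-- The function `(ln |x|)^{α/2}`, considered for `|x| → ∞`. -/
def logGrowth (n : ℕ) (α : ℝ) (x : EuclideanSpace ℝ (Fin n)) : ℝ :=
  Real.log ‖x‖ ^ (α / 2)

end GaussLip

end

/-!
The function `f = [ln(e + |x|)]^{α/2}` satisfies the Lipschitz-type condition: it is the `α`-th power
of the Lipschitz function `√ln(e + |x|)`, and `u ↦ u^{α/2}` is subadditive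
(`lipCondition_logExample`). Everything about the Poisson integral then follows from the fact that
*every* function `g` with the Lipschitz-type condition belongs to `GGLip_α`
(`memGGLip_of_lipCondition`).

To see this, write the Poisson integral by subordination as a constant times
`∫ k_t(s) T_s g(x) ds`, with `k_t(s) = t s^{-3/2} e^{-t²/(4s)}` and
`T_s g(x) = ∫ M_{e^{-s}}(x, y) g(y) dy = ∫ e^{-|z|²} g(e^{-s} x + √(1 - e^{-2s}) z) dz`. The total
mass of `k_t` does not depend on `t` (`integral_subordDensityDeriv`), so that `g(x)` times the
Gaussian mass `m` may be subtracted from `T_s g(x)` in the `t`-derivative. Moreover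
`|T_s g(x) - m g(x)| ≤ C s^{α/2}` uniformly in `x`
(`exists_integral_mehlerKernel_mul_abs_sub_le`): the contraction `x ↦ e^{-s} x` moves `x` by at most
`s` for the logarithmic distance `d`, and the Gaussian displacement has size at most `√(2s) |z|`.
Both alternatives in the minimum of the condition are needed here. Finally
`∫ s^{α/2} |∂_t k_t(s)| ds` is a convergent Gamma integral of size `t^{α - 1}`, because `α < 1`
(`integral_rpow_mul_majorant`).

The growth bound is the condition at `y = 0`, where `d(x, 0) = ln(1 + |x|)`; the sharpness follows
from `f ~ (ln |x|)^{α/2}`.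
-/

noncomputable section

namespace GaussLip

/-! ### The Lipschitz-type condition -/

lemma abs_rpow_sub_rpow_le {u v p : ℝ} (hu : 0 ≤ u) (hv : 0 ≤ v) (hp : 0 ≤ p) (hp1 : p ≤ 1) :
    |u ^ p - v ^ p| ≤ |u - v| ^ p := by
  wlog h : v ≤ u generalizing u v
  · rw [abs_sub_comm, abs_sub_comm u v]
    exact this hv hu (le_of_not_ge h)
  rw [abs_of_nonneg (sub_nonneg.2 (Real.rpow_le_rpow hv h hp)), abs_of_nonneg (sub_nonneg.2 h)]
  have := Real.rpow_add_le_add_rpow (sub_nonneg.2 h) hv hp hp1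
  rw [sub_add_cancel] at this
  linarith

lemma one_le_log_exp_one_add {a : ℝ} (ha : 0 ≤ a) : 1 ≤ Real.log (Real.exp 1 + a) := by
  rw [Real.le_log_iff_exp_le (by positivity)]
  linarith

/-- The difference of logarithms decreases when the argument is shifted to the right. -/
lemma abs_log_add_sub_log_add_le {c d a b : ℝ} (hc : 0 < c) (hcd : c ≤ d) (ha : 0 ≤ a)
    (hb : 0 ≤ b) :
    |Real.log (d + a) - Real.log (d + b)| ≤ |Real.log (c + a) - Real.log (c + b)| := by
  wlog h : b ≤ a generalizing a b
  · rw [abs_sub_comm, abs_sub_comm (Real.log (c + a))]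
    exact this hb ha (le_of_not_ge h)
  have hd : 0 < d := hc.trans_le hcd
  rw [abs_of_nonneg (sub_nonneg.2 (Real.log_le_log (by positivity) (by linarith))),
    abs_of_nonneg (sub_nonneg.2 (Real.log_le_log (by positivity) (by linarith))),
    ← Real.log_div (by positivity) (by positivity), ← Real.log_div (by positivity) (by positivity)]
  refine Real.log_le_log (by positivity) ?_
  rw [div_le_div_iff₀ (by positivity) (by positivity)]
  nlinarith

lemma abs_log_one_add_sub_le {a b : ℝ} (ha : 0 ≤ a) (hb : 0 ≤ b) :
    |Real.log (1 + a) - Real.log (1 + b)| ≤ |a - b| := by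
  wlog h : b ≤ a generalizing a b
  · rw [abs_sub_comm, abs_sub_comm a]
    exact this hb ha (le_of_not_ge h)
  rw [abs_of_nonneg (sub_nonneg.2 (Real.log_le_log (by positivity) (by linarith))),
    abs_of_nonneg (sub_nonneg.2 h), ← Real.log_div (by positivity) (by positivity)]
  refine (Real.log_le_sub_one_of_pos (by positivity)).trans ?_
  rw [sub_le_iff_le_add, div_le_iff₀ (by positivity)]
  nlinarith

variable {n : ℕ} {α : ℝ}

lemma abs_logExample_sub_le_log (hα₀ : 0 < α) (hα₁ : α < 1) (x y : EuclideanSpace ℝ (Fin n)) :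
    |logExample n α x - logExample n α y| ≤
      |Real.log (Real.exp 1 + ‖x‖) - Real.log (Real.exp 1 + ‖y‖)| ^ (α / 2) :=
  abs_rpow_sub_rpow_le (zero_le_one.trans (one_le_log_exp_one_add (norm_nonneg x)))
    (zero_le_one.trans (one_le_log_exp_one_add (norm_nonneg y))) (by linarith) (by linarith)

/-- The function is the `α`-th power of `√ln(e + |x|)`, which is Lipschitz because
`ln(e + |x|) ≥ 1`. -/
lemma abs_logExample_sub_le_norm (hα₀ : 0 < α) (hα₁ : α < 1) (x y : EuclideanSpace ℝ (Fin n)) :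
    |logExample n α x - logExample n α y| ≤ ‖x - y‖ ^ α := by
  have hu := one_le_log_exp_one_add (norm_nonneg x)
  have hv := one_le_log_exp_one_add (norm_nonneg y)
  have hlog : |Real.log (Real.exp 1 + ‖x‖) - Real.log (Real.exp 1 + ‖y‖)| ≤ ‖x - y‖ :=
    (abs_log_add_sub_log_add_le one_pos (Real.one_le_exp zero_le_one) (norm_nonneg x)
      (norm_nonneg y)).trans ((abs_log_one_add_sub_le (norm_nonneg x) (norm_nonneg y)).trans
        (abs_norm_sub_norm_le x y))
  unfold logExample
  set u := Real.log (Real.exp 1 + ‖x‖)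
  set v := Real.log (Real.exp 1 + ‖y‖)
  have hsqrt : ∀ w : ℝ, 0 ≤ w → w ^ (α / 2) = (√w) ^ α := fun w hw => by
    rw [Real.sqrt_eq_rpow, ← Real.rpow_mul hw]
    ring_nf
  rw [hsqrt u (by linarith), hsqrt v (by linarith)]
  refine (abs_rpow_sub_rpow_le (Real.sqrt_nonneg u) (Real.sqrt_nonneg v) hα₀.le hα₁.le).trans
    (Real.rpow_le_rpow (abs_nonneg _) (le_trans ?_ hlog) hα₀.le)
  have hfac : u - v = (√u - √v) * (√u + √v) := by
    have h1 := Real.sq_sqrt (show 0 ≤ u by linarith)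
    have h2 := Real.sq_sqrt (show 0 ≤ v by linarith)
    linear_combination h2 - h1
  rw [hfac, abs_mul]
  refine le_mul_of_one_le_right (abs_nonneg _) (le_abs.2 (Or.inl ?_))
  have h1 := Real.one_le_sqrt.2 hu
  have h2 := Real.sqrt_nonneg v
  linarith

lemma abs_log_sub_log_le_dPar (x y : EuclideanSpace ℝ (Fin n)) :
    |Real.log (Real.exp 1 + ‖x‖) - Real.log (Real.exp 1 + ‖par x y‖)| ≤ dPar x y := by
  refine (abs_log_add_sub_log_add_le one_pos (Real.one_le_exp zero_le_one) (norm_nonneg _)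
    (norm_nonneg _)).trans ?_
  have h1 : 0 ≤ Real.log (1 + ‖x‖) := Real.log_nonneg (by linarith [norm_nonneg x])
  have h2 : 0 ≤ Real.log (1 + ‖par x y‖) := Real.log_nonneg (by linarith [norm_nonneg (par x y)])
  unfold dPar sgn
  split_ifs
  · rw [abs_le, neg_one_mul, sub_neg_eq_add, abs_of_nonneg (add_nonneg h1 h2)]
    constructor <;> linarith
  · rw [one_mul]

theorem lipCondition_logExample (hα₀ : 0 < α) (hα₁ : α < 1) :
    LipCondition α (logExample n α) := by
  refine ⟨1, one_pos, fun x y => ?_⟩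
  rw [one_mul]
  refine le_min (abs_logExample_sub_le_norm hα₀ hα₁ x y) ?_
  refine (abs_sub_le _ (logExample n α (par x y)) _).trans (add_le_add ?_ ?_)
  · exact (abs_logExample_sub_le_log hα₀ hα₁ _ _).trans (Real.rpow_le_rpow (abs_nonneg _)
      (abs_log_sub_log_le_dPar x y) (by linarith))
  · rw [perp, norm_sub_rev]
    exact abs_logExample_sub_le_norm hα₀ hα₁ _ _

lemma par_smul (r : ℝ) (x : EuclideanSpace ℝ (Fin n)) : par x (r • x) = r • x := by
  unfold par
  split_ifs with h
  · rfl
  · rw [real_inner_smul_right, real_inner_self_eq_norm_sq, mul_div_cancel_right₀]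
    exact pow_ne_zero 2 (norm_ne_zero_iff.2 h)

lemma perp_smul (r : ℝ) (x : EuclideanSpace ℝ (Fin n)) : perp x (r • x) = 0 := by
  rw [perp, par_smul, sub_self]

lemma dPar_smul {r : ℝ} (hr : 0 ≤ r) (x : EuclideanSpace ℝ (Fin n)) :
    dPar x (r • x) = |Real.log (1 + ‖x‖) - Real.log (1 + r * ‖x‖)| := by
  have h : ¬ inner ℝ x (r • x) < 0 := by
    rw [real_inner_smul_right, real_inner_self_eq_norm_sq]
    exact not_lt.2 (by positivity)
  rw [dPar, par_smul, sgn, if_neg h, one_mul, norm_smul, Real.norm_of_nonneg hr]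

/-- A contraction by the factor `e^{-s}` moves a point by at most `s` for the logarithmic distance
`d`. -/
lemma dPar_exp_neg_smul_le {s : ℝ} (hs : 0 ≤ s) (x : EuclideanSpace ℝ (Fin n)) :
    dPar x (Real.exp (-s) • x) ≤ s := by
  have hx := norm_nonneg x
  have hE := Real.exp_pos (-s)
  have hE1 : Real.exp (-s) ≤ 1 := Real.exp_le_one_iff.2 (by linarith)
  rw [dPar_smul hE.le, abs_of_nonneg
    (sub_nonneg.2 (Real.log_le_log (by positivity) (by nlinarith))), sub_le_iff_le_add,
    Real.log_le_iff_le_exp (by positivity), Real.exp_add, Real.exp_log (by positivity), mul_add,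
    ← mul_assoc, ← Real.exp_add, add_neg_cancel, Real.exp_zero]
  linarith [Real.one_le_exp hs]

lemma abs_sub_le_of_lipCondition_exp_smul {K s : ℝ} {g : EuclideanSpace ℝ (Fin n) → ℝ}
    (hα₀ : 0 < α) (hK : 0 < K) (hs : 0 ≤ s)
    (hg : ∀ x y, |g x - g y| ≤ K * min (‖x - y‖ ^ α) (dPar x y ^ (α / 2) + ‖perp x y‖ ^ α))
    (x : EuclideanSpace ℝ (Fin n)) :
    |g (Real.exp (-s) • x) - g x| ≤ K * s ^ (α / 2) := by
  rw [abs_sub_comm]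
  refine (hg _ _).trans (mul_le_mul_of_nonneg_left ((min_le_right _ _).trans ?_) hK.le)
  rw [perp_smul, norm_zero, Real.zero_rpow hα₀.ne', add_zero]
  exact Real.rpow_le_rpow (abs_nonneg _) (dPar_exp_neg_smul_le hs x) (by linarith)

lemma continuous_of_abs_sub_le {K : ℝ} {g : EuclideanSpace ℝ (Fin n) → ℝ} (hα₀ : 0 < α)
    (hg : ∀ x y, |g x - g y| ≤ K * ‖x - y‖ ^ α) : Continuous g := by
  refine continuous_iff_continuousAt.2 fun x => tendsto_iff_norm_sub_tendsto_zero.2 ?_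
  have h : Continuous fun y => K * ‖y - x‖ ^ α :=
    continuous_const.mul ((continuous_id.sub continuous_const).norm.rpow_const
      fun _ => Or.inr hα₀.le)
  have h0 := h.tendsto x
  rw [sub_self, norm_zero, Real.zero_rpow hα₀.ne', mul_zero] at h0
  exact squeeze_zero (fun _ => norm_nonneg _) (fun y => hg y x) h0

/-! ### Growth at infinity -/

/-- Comparing with the value at the origin gives `|g(x)| ≤ |g(0)| + K (ln(1 + |x|))^{α/2}`, since
`d(x, 0) = ln(1 + |x|)`. -/
theorem isBigO_logGrowth_of_lipCondition (hα₀ : 0 < α) {g : EuclideanSpace ℝ (Fin n) → ℝ}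
    (hg : LipCondition α g) :
    g =O[cocompact (EuclideanSpace ℝ (Fin n))] logGrowth n α := by
  obtain ⟨K, hK, hg⟩ := hg
  refine IsBigO.of_bound (|g 0| + K * 2 ^ (α / 2)) ?_
  have hlarge : ∀ᶠ x in cocompact (EuclideanSpace ℝ (Fin n)), Real.exp 1 ≤ ‖x‖ :=
    tendsto_norm_cocompact_atTop.eventually_ge_atTop _
  filter_upwards [hlarge] with x hx
  have hx2 : 2 ≤ ‖x‖ := by linarith [Real.add_one_le_exp (1 : ℝ)]
  have hlog : 1 ≤ Real.log ‖x‖ := (Real.le_log_iff_exp_le (by linarith)).2 hx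
  have hL : 1 ≤ Real.log ‖x‖ ^ (α / 2) := Real.one_le_rpow hlog (by linarith)
  -- `1 + |x| ≤ |x|²` for `|x| ≥ 2`
  have hd : dPar x 0 ≤ 2 * Real.log ‖x‖ := by
    have h := dPar_smul (le_refl (0 : ℝ)) x
    rw [zero_smul, zero_mul, add_zero, Real.log_one, sub_zero,
      abs_of_nonneg (Real.log_nonneg (by linarith))] at h
    rw [h, two_mul, ← Real.log_mul (by positivity) (by positivity)]
    exact Real.log_le_log (by positivity) (by nlinarith)
  have hp : perp x (0 : EuclideanSpace ℝ (Fin n)) = 0 := by simpa using perp_smul 0 x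
  have h1 : |g x - g 0| ≤ K * (2 ^ (α / 2) * Real.log ‖x‖ ^ (α / 2)) := by
    refine (hg x 0).trans (mul_le_mul_of_nonneg_left ((min_le_right _ _).trans ?_) hK.le)
    rw [hp, norm_zero, Real.zero_rpow hα₀.ne', add_zero, ← Real.mul_rpow zero_le_two (by linarith)]
    exact Real.rpow_le_rpow (abs_nonneg _) hd (by linarith)
  have h2 : |g x| ≤ |g 0| + |g x - g 0| := by
    linarith [abs_sub_abs_le_abs_sub (g x) (g 0)]
  rw [Real.norm_eq_abs, Real.norm_eq_abs, logGrowth,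
    abs_of_nonneg (zero_le_one.trans hL), add_mul]
  nlinarith [abs_nonneg (g 0)]

lemma tendsto_logGrowth (hα₀ : 0 < α) :
    Tendsto (logGrowth n α) (cocompact (EuclideanSpace ℝ (Fin n))) atTop :=
  (tendsto_rpow_atTop (by linarith : 0 < α / 2)).comp
    (Real.tendsto_log_atTop.comp tendsto_norm_cocompact_atTop)

/-- The difference of the two functions stays bounded while `(ln |x|)^{α/2}` tends to infinity. -/
theorem isEquivalent_logExample_logGrowth (hα₀ : 0 < α) (hα₁ : α < 1) :
    logExample n α ~[cocompact (EuclideanSpace ℝ (Fin n))] logGrowth n α := by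
  have hbdd : (logExample n α - logGrowth n α) =O[cocompact (EuclideanSpace ℝ (Fin n))]
      (fun _ => (1 : ℝ)) := by
    refine IsBigO.of_bound 1 ?_
    have hlarge : ∀ᶠ x in cocompact (EuclideanSpace ℝ (Fin n)), Real.exp 1 ≤ ‖x‖ :=
      tendsto_norm_cocompact_atTop.eventually_ge_atTop _
    filter_upwards [hlarge] with x hx
    have he := Real.exp_pos 1
    have hx0 : 0 < ‖x‖ := he.trans_le hx
    have h1 : Real.log ‖x‖ ≤ Real.log (Real.exp 1 + ‖x‖) := Real.log_le_log hx0 (by linarith)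
    have h2 : Real.log (Real.exp 1 + ‖x‖) - Real.log ‖x‖ ≤ 1 := by
      rw [← Real.log_div (by positivity) (by positivity)]
      refine (Real.log_le_sub_one_of_pos (by positivity)).trans ?_
      rw [sub_le_iff_le_add, div_le_iff₀ hx0]
      linarith
    have h0 : 0 ≤ Real.log ‖x‖ :=
      zero_le_one.trans ((Real.le_log_iff_exp_le hx0).2 hx)
    rw [Pi.sub_apply, Real.norm_eq_abs, norm_one, mul_one, logExample, logGrowth]
    refine (abs_rpow_sub_rpow_le (h0.trans h1) h0 (by linarith) (by linarith)).trans ?_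
    rw [abs_of_nonneg (sub_nonneg.2 h1)]
    exact Real.rpow_le_one (sub_nonneg.2 h1) h2 (by linarith)
  exact hbdd.trans_isLittleO ((isLittleO_const_left).2 (Or.inr
    (tendsto_norm_atTop_atTop.comp (tendsto_logGrowth hα₀))))

/-! ### The subordination density -/

/-- The substitution `s ↦ 1 / s` turns the density into the integrand of the Gamma function. -/
lemma rpow_neg_mul_exp_neg_div_eq {q a s : ℝ} (hs : 0 < s) :
    s ^ (-q - 1) * Real.exp (-(a / s)) =
      (|(-1 : ℝ)| * s ^ ((-1 : ℝ) - 1)) •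
        ((s ^ (-1 : ℝ)) ^ (q - 1) * Real.exp (-(a * s ^ (-1 : ℝ)))) := by
  rw [abs_neg, abs_one, one_mul, smul_eq_mul, ← mul_assoc, ← Real.rpow_mul hs.le,
    ← Real.rpow_add hs, Real.rpow_neg_one, div_eq_mul_inv]
  congr 2
  ring

lemma integrableOn_rpow_neg_mul_exp_neg_div {q a : ℝ} (hq : 0 < q) (ha : 0 < a) :
    IntegrableOn (fun s => s ^ (-q - 1) * Real.exp (-(a / s))) (Set.Ioi 0) := by
  have h := integrableOn_rpow_mul_exp_neg_mul_rpow (p := 1) (s := q - 1) (by linarith) one_pos ha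
  simp only [Real.rpow_one, neg_mul] at h
  exact ((integrableOn_Ioi_comp_rpow_iff _ (by norm_num : (-1 : ℝ) ≠ 0)).2 h).congr_fun
    (fun s hs => (rpow_neg_mul_exp_neg_div_eq hs).symm) measurableSet_Ioi

lemma integral_rpow_neg_mul_exp_neg_div {q a : ℝ} (hq : 0 < q) (ha : 0 < a) :
    ∫ s in Set.Ioi (0 : ℝ), s ^ (-q - 1) * Real.exp (-(a / s)) =
      (1 / a) ^ q * Real.Gamma q := by
  rw [setIntegral_congr_fun measurableSet_Ioi fun s hs => rpow_neg_mul_exp_neg_div_eq hs,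
    integral_comp_rpow_Ioi (fun u : ℝ => u ^ (q - 1) * Real.exp (-(a * u)))
      (by norm_num : (-1 : ℝ) ≠ 0)]
  exact Real.integral_rpow_mul_exp_neg_mul_Ioi hq ha

/-- The unnormalized density `t s^{-3/2} e^{-t²/(4s)}` of the `1/2`-stable subordinator. -/
def subordDensity (t s : ℝ) : ℝ := t / s ^ ((3 : ℝ) / 2) * Real.exp (-(t ^ 2 / (4 * s)))

/-- The derivative `(1 - t² / (2s)) s^{-3/2} e^{-t²/(4s)}` of the subordination density with
respect to `t`. -/
def subordDensityDeriv (t s : ℝ) : ℝ :=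
  s ^ (-(1 / 2 : ℝ) - 1) * Real.exp (-(t ^ 2 / 4 / s)) -
    t ^ 2 / 2 * (s ^ (-(3 / 2 : ℝ) - 1) * Real.exp (-(t ^ 2 / 4 / s)))

lemma subordDensity_eq {t s : ℝ} (hs : 0 < s) :
    subordDensity t s = t * (s ^ (-(1 / 2 : ℝ) - 1) * Real.exp (-(t ^ 2 / 4 / s))) := by
  rw [subordDensity, div_eq_mul_inv, ← Real.rpow_neg hs.le, mul_assoc, div_div]
  norm_num

lemma hasDerivAt_subordDensity {t s : ℝ} (hs : 0 < s) :
    HasDerivAt (fun τ => subordDensity τ s) (subordDensityDeriv t s) t := by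
  have hfun : (fun τ => subordDensity τ s) =
      fun τ => τ * (s ^ (-(1 / 2 : ℝ) - 1) * Real.exp (-(τ ^ 2 / 4 / s))) :=
    funext fun τ => subordDensity_eq hs
  rw [hfun]
  have h1 : HasDerivAt (fun τ : ℝ => -(τ ^ 2 / 4 / s)) (-(2 * t / 4 / s)) t := by
    simpa using (((hasDerivAt_pow 2 t).div_const 4).div_const s).fun_neg
  refine ((hasDerivAt_id' t).fun_mul (h1.exp.const_mul (s ^ (-(1 / 2 : ℝ) - 1)))).congr_deriv ?_
  have h2 : s ^ (-(3 / 2 : ℝ) - 1) = s ^ (-(1 / 2 : ℝ) - 1) / s := by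
    rw [← Real.rpow_sub_one hs.ne']
    norm_num
  rw [subordDensityDeriv, h2]
  field_simp
  ring

lemma measurable_subordDensity (t : ℝ) : Measurable (subordDensity t) := by
  unfold subordDensity
  fun_prop

lemma measurable_subordDensityDeriv (t : ℝ) : Measurable (subordDensityDeriv t) := by
  unfold subordDensityDeriv
  fun_prop

lemma subordDensity_nonneg {t s : ℝ} (ht : 0 ≤ t) (hs : 0 < s) : 0 ≤ subordDensity t s := by
  unfold subordDensity
  positivity

lemma rpow_mul_rpow_neg_mul_exp {b q a s : ℝ} (hs : 0 < s) :
    s ^ b * (s ^ (-q - 1) * Real.exp (-(a / s))) =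
      s ^ (-(q - b) - 1) * Real.exp (-(a / s)) := by
  rw [← mul_assoc, ← Real.rpow_add hs]
  congr 2
  ring

/-- A majorant of `|∂_t k_t(s)|` for `b ≤ t ≤ B`. It serves with `b < t < B` to differentiate under
the integral sign, and with `b = t = B` for the final estimate. -/
lemma abs_subordDensityDeriv_le {t b B s : ℝ} (hb : 0 ≤ b) (hbt : b ≤ t) (htB : t ≤ B)
    (hs : 0 < s) :
    |subordDensityDeriv t s| ≤ s ^ (-(1 / 2 : ℝ) - 1) * Real.exp (-(b ^ 2 / 4 / s)) +
      B ^ 2 / 2 * (s ^ (-(3 / 2 : ℝ) - 1) * Real.exp (-(b ^ 2 / 4 / s))) := by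
  have ht : 0 ≤ t := hb.trans hbt
  have hexp : Real.exp (-(t ^ 2 / 4 / s)) ≤ Real.exp (-(b ^ 2 / 4 / s)) := by gcongr
  refine (abs_sub _ _).trans ?_
  rw [abs_of_nonneg (by positivity), abs_of_nonneg (by positivity)]
  gcongr

/-- The total mass of the subordination density does not depend on `t`. -/
lemma integral_subordDensityDeriv {t : ℝ} (ht : 0 < t) :
    ∫ s in Set.Ioi (0 : ℝ), subordDensityDeriv t s = 0 := by
  have ha : 0 < t ^ 2 / 4 := by positivity
  unfold subordDensityDeriv
  rw [integral_sub (integrableOn_rpow_neg_mul_exp_neg_div (by norm_num) ha)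
    ((integrableOn_rpow_neg_mul_exp_neg_div (by norm_num) ha).const_mul _),
    integral_const_mul, integral_rpow_neg_mul_exp_neg_div (by norm_num) ha,
    integral_rpow_neg_mul_exp_neg_div (by norm_num) ha,
    show (3 / 2 : ℝ) = 1 / 2 + 1 by norm_num, Real.Gamma_add_one (by norm_num),
    Real.rpow_add_one (by positivity)]
  field_simp
  ring

lemma integrableOn_rpow_mul_subordDensity {t b : ℝ} (ht : 0 < t) (hb : b < 1 / 2) :
    IntegrableOn (fun s => s ^ b * subordDensity t s) (Set.Ioi 0) := by
  have h := (integrableOn_rpow_neg_mul_exp_neg_div (q := 1 / 2 - b) (a := t ^ 2 / 4)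
    (by linarith) (by positivity)).const_mul t
  refine IntegrableOn.congr_fun h (fun s hs => ?_) measurableSet_Ioi
  rw [subordDensity_eq hs, ← rpow_mul_rpow_neg_mul_exp hs]
  ring

lemma integrableOn_rpow_mul_majorant {b c B : ℝ} (hb : 0 < b) (hc : c < 1 / 2) :
    IntegrableOn (fun s => s ^ c * (s ^ (-(1 / 2 : ℝ) - 1) * Real.exp (-(b ^ 2 / 4 / s)) +
      B ^ 2 / 2 * (s ^ (-(3 / 2 : ℝ) - 1) * Real.exp (-(b ^ 2 / 4 / s))))) (Set.Ioi 0) := by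
  have h := (integrableOn_rpow_neg_mul_exp_neg_div (q := 1 / 2 - c) (a := b ^ 2 / 4)
    (by linarith) (by positivity)).add ((integrableOn_rpow_neg_mul_exp_neg_div (q := 3 / 2 - c)
    (a := b ^ 2 / 4) (by linarith) (by positivity)).const_mul (B ^ 2 / 2))
  refine IntegrableOn.congr_fun h (fun s hs => ?_) measurableSet_Ioi
  simp only [Pi.add_apply]
  rw [← rpow_mul_rpow_neg_mul_exp hs, ← rpow_mul_rpow_neg_mul_exp hs]
  ring

/-- By homogeneity, `∫ s^c |∂_t k_t(s)| ds` is at most a multiple of `t^{2c - 1}`; here the integral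
of the majorant is computed. -/
lemma integral_rpow_mul_majorant {t c : ℝ} (ht : 0 < t) (hc : c < 1 / 2) :
    ∫ s in Set.Ioi (0 : ℝ), s ^ c * (s ^ (-(1 / 2 : ℝ) - 1) * Real.exp (-(t ^ 2 / 4 / s)) +
      t ^ 2 / 2 * (s ^ (-(3 / 2 : ℝ) - 1) * Real.exp (-(t ^ 2 / 4 / s)))) =
    4 ^ (1 / 2 - c) * (Real.Gamma (1 / 2 - c) + 2 * Real.Gamma (3 / 2 - c)) * t ^ (2 * c - 1) := by
  have ha : 0 < t ^ 2 / 4 := by positivity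
  have h1 : ∀ s ∈ Set.Ioi (0 : ℝ),
      s ^ c * (s ^ (-(1 / 2 : ℝ) - 1) * Real.exp (-(t ^ 2 / 4 / s)) +
        t ^ 2 / 2 * (s ^ (-(3 / 2 : ℝ) - 1) * Real.exp (-(t ^ 2 / 4 / s)))) =
      s ^ (-(1 / 2 - c) - 1) * Real.exp (-(t ^ 2 / 4 / s)) +
        t ^ 2 / 2 * (s ^ (-(3 / 2 - c) - 1) * Real.exp (-(t ^ 2 / 4 / s))) := fun s hs => by
    rw [← rpow_mul_rpow_neg_mul_exp hs, ← rpow_mul_rpow_neg_mul_exp hs]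
    ring
  rw [setIntegral_congr_fun measurableSet_Ioi h1,
    integral_add (integrableOn_rpow_neg_mul_exp_neg_div (by linarith) ha)
      ((integrableOn_rpow_neg_mul_exp_neg_div (by linarith) ha).const_mul _),
    integral_const_mul, integral_rpow_neg_mul_exp_neg_div (by linarith) ha,
    integral_rpow_neg_mul_exp_neg_div (by linarith) ha,
    show 3 / 2 - c = (1 / 2 - c) + 1 by ring, Real.rpow_add_one (by positivity)]
  have h2 : (1 / (t ^ 2 / 4)) ^ (1 / 2 - c) = 4 ^ (1 / 2 - c) * t ^ (2 * c - 1) := by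
    rw [one_div_div, Real.div_rpow (by norm_num) (by positivity), ← Real.rpow_natCast t 2,
      ← Real.rpow_mul ht.le, div_eq_mul_inv, ← Real.rpow_neg ht.le]
    congr 2
    push_cast
    ring
  rw [h2]
  field_simp
  ring

/-! ### The Mehler kernel -/

/-- The Mehler kernel is the Gaussian `e^{-|z|²}` transported by `z ↦ r x + √(1 - r²) z`. -/
lemma mehlerKernel_add_smul {r : ℝ} (hr : r ^ 2 < 1) (x z : EuclideanSpace ℝ (Fin n)) :
    mehlerKernel r x (r • x + √(1 - r ^ 2) • z) =
      Real.exp (-‖z‖ ^ 2) / √(1 - r ^ 2) ^ n := by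
  have h : 0 < 1 - r ^ 2 := by linarith
  rw [mehlerKernel, add_sub_cancel_left, norm_smul, Real.norm_of_nonneg (Real.sqrt_nonneg _),
    mul_pow, Real.sq_sqrt h.le, mul_div_cancel_left₀ _ h.ne', Real.sqrt_eq_rpow,
    ← Real.rpow_mul_natCast h.le]
  congr 2
  ring

lemma integrable_mehlerKernel_mul_iff {r : ℝ} (hr : r ^ 2 < 1) (x : EuclideanSpace ℝ (Fin n))
    (h : EuclideanSpace ℝ (Fin n) → ℝ) :
    Integrable (fun y => mehlerKernel r x y * h y) ↔
      Integrable (fun z => Real.exp (-‖z‖ ^ 2) * h (r • x + √(1 - r ^ 2) • z)) := by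
  have hσ : 0 < √(1 - r ^ 2) := Real.sqrt_pos.2 (by linarith)
  rw [← (measurePreserving_add_left volume (r • x)).integrable_comp_emb
      (MeasurableEquiv.addLeft (r • x)).measurableEmbedding,
    ← integrable_comp_smul_iff volume _ hσ.ne',
    ← integrable_const_mul_iff (isUnit_iff_ne_zero.2 (pow_ne_zero n hσ.ne'))
      (fun z => ((fun y => mehlerKernel r x y * h y) ∘ fun w => r • x + w) (√(1 - r ^ 2) • z))]
  refine integrable_congr (Eventually.of_forall fun z => ?_)
  simp only [Function.comp_apply]
  rw [mehlerKernel_add_smul hr]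
  field_simp

lemma integral_mehlerKernel_mul {r : ℝ} (hr : r ^ 2 < 1) (x : EuclideanSpace ℝ (Fin n))
    (h : EuclideanSpace ℝ (Fin n) → ℝ) :
    ∫ y, mehlerKernel r x y * h y =
      ∫ z, Real.exp (-‖z‖ ^ 2) * h (r • x + √(1 - r ^ 2) • z) := by
  have hσ : 0 < √(1 - r ^ 2) := Real.sqrt_pos.2 (by linarith)
  have hscale := Measure.integral_comp_smul volume
    (fun w => mehlerKernel r x (r • x + w) * h (r • x + w)) √(1 - r ^ 2)
  rw [integral_add_left_eq_self (fun y => mehlerKernel r x y * h y), finrank_euclideanSpace_fin,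
    abs_of_pos (by positivity), smul_eq_mul, eq_inv_mul_iff_mul_eq₀ (by positivity),
    ← integral_const_mul] at hscale
  rw [← hscale]
  refine integral_congr_ae (Eventually.of_forall fun z => ?_)
  simp only []
  rw [mehlerKernel_add_smul hr]
  field_simp

lemma exp_neg_sq_lt_one {s : ℝ} (hs : 0 < s) : Real.exp (-s) ^ 2 < 1 := by
  rw [← Real.exp_nat_mul, Real.exp_lt_one_iff]
  push_cast
  linarith

lemma measurable_mehlerKernel (x : EuclideanSpace ℝ (Fin n)) :
    Measurable fun p : ℝ × EuclideanSpace ℝ (Fin n) => mehlerKernel (Real.exp (-p.1)) x p.2 := by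
  unfold mehlerKernel
  fun_prop

lemma mehlerKernel_nonneg {r : ℝ} (hr : r ^ 2 < 1) (x y : EuclideanSpace ℝ (Fin n)) :
    0 ≤ mehlerKernel r x y := by
  have h : 0 < 1 - r ^ 2 := by linarith
  unfold mehlerKernel
  positivity

lemma integrable_exp_neg_mul_norm_sq {b : ℝ} (hb : 0 < b) :
    Integrable fun z : EuclideanSpace ℝ (Fin n) => Real.exp (-b * ‖z‖ ^ 2) := by
  have h := (GaussianFourier.integrable_cexp_neg_mul_sq_norm_add (b := (b : ℂ))
    (V := EuclideanSpace ℝ (Fin n)) (by simpa using hb) 0 0).norm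
  refine h.congr (Eventually.of_forall fun z => ?_)
  simp [Complex.norm_exp, ← Complex.ofReal_pow]

lemma integrable_exp_neg_norm_sq :
    Integrable fun z : EuclideanSpace ℝ (Fin n) => Real.exp (-‖z‖ ^ 2) := by
  simpa using integrable_exp_neg_mul_norm_sq (n := n) one_pos

lemma integrable_exp_neg_norm_sq_mul_rpow (hα₀ : 0 < α) (hα₁ : α < 1) :
    Integrable fun z : EuclideanSpace ℝ (Fin n) => Real.exp (-‖z‖ ^ 2) * ‖z‖ ^ α := by
  refine ((integrable_exp_neg_mul_norm_sq (n := n) (b := 1 / 2) (by norm_num)).const_mul 2).mono'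
    (by fun_prop) (Eventually.of_forall fun z => ?_)
  have hz := norm_nonneg z
  rw [Real.norm_of_nonneg (by positivity)]
  have hsplit : Real.exp (-‖z‖ ^ 2) =
      Real.exp (-(1 / 2) * ‖z‖ ^ 2) * Real.exp (-(1 / 2) * ‖z‖ ^ 2) := by
    rw [← Real.exp_add]
    ring_nf
  -- `|z|^α ≤ 1 + |z|² ≤ 2 e^{|z|²/2}`
  have h1 : ‖z‖ ^ α ≤ 1 + ‖z‖ ^ 2 := by
    rcases le_total ‖z‖ 1 with h | h
    · linarith [Real.rpow_le_one hz h hα₀.le, sq_nonneg ‖z‖]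
    · have := Real.rpow_le_rpow_of_exponent_le h hα₁.le
      rw [Real.rpow_one] at this
      nlinarith
  have h2 : Real.exp (-(1 / 2) * ‖z‖ ^ 2) * (1 + ‖z‖ ^ 2) ≤ 2 := by
    rw [neg_mul, Real.exp_neg, inv_mul_le_iff₀ (Real.exp_pos _)]
    linarith [Real.add_one_le_exp (1 / 2 * ‖z‖ ^ 2)]
  rw [hsplit, mul_assoc, mul_comm (2 : ℝ)]
  exact mul_le_mul_of_nonneg_left ((mul_le_mul_of_nonneg_left h1 (Real.exp_pos _).le).trans h2)
    (Real.exp_pos _).le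

/-- The Gaussian mean of `|g - g(x)|` at time `s` is `O(s^{α/2})`, uniformly in `x`: the contraction
to `e^{-s} x` and the Gaussian displacement by `√(1 - e^{-2s}) |z| ≤ √(2s) |z|` both cost at most
this much. -/
theorem exists_integral_mehlerKernel_mul_abs_sub_le (hα₀ : 0 < α) (hα₁ : α < 1)
    {g : EuclideanSpace ℝ (Fin n) → ℝ} (hg : LipCondition α g) :
    ∃ C : ℝ, 0 < C ∧ ∀ s : ℝ, 0 < s → ∀ x,
      Integrable (fun y => mehlerKernel (Real.exp (-s)) x y * |g y - g x|) ∧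
        ∫ y, mehlerKernel (Real.exp (-s)) x y * |g y - g x| ≤ C * s ^ (α / 2) := by
  obtain ⟨K, hK, hg⟩ := hg
  have hHol : ∀ x y, |g x - g y| ≤ K * ‖x - y‖ ^ α := fun x y =>
    (hg x y).trans (mul_le_mul_of_nonneg_left (min_le_left _ _) hK.le)
  have hcont : Continuous g := continuous_of_abs_sub_le hα₀ hHol
  have hint : Integrable fun z : EuclideanSpace ℝ (Fin n) =>
      Real.exp (-‖z‖ ^ 2) + 2 * (Real.exp (-‖z‖ ^ 2) * ‖z‖ ^ α) :=
    integrable_exp_neg_norm_sq.add ((integrable_exp_neg_norm_sq_mul_rpow hα₀ hα₁).const_mul 2)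
  set I := ∫ z : EuclideanSpace ℝ (Fin n),
    (Real.exp (-‖z‖ ^ 2) + 2 * (Real.exp (-‖z‖ ^ 2) * ‖z‖ ^ α))
  have hI : 0 ≤ I := integral_nonneg fun z => by positivity
  refine ⟨K * I + 1, by positivity, fun s hs x => ?_⟩
  have hr := exp_neg_sq_lt_one hs
  have hbound : ∀ z : EuclideanSpace ℝ (Fin n), Real.exp (-‖z‖ ^ 2) *
      |g (Real.exp (-s) • x + √(1 - Real.exp (-s) ^ 2) • z) - g x| ≤
      K * s ^ (α / 2) * (Real.exp (-‖z‖ ^ 2) + 2 * (Real.exp (-‖z‖ ^ 2) * ‖z‖ ^ α)) := fun z => by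
    have h1 := abs_sub_le_of_lipCondition_exp_smul hα₀ hK hs.le hg x
    have hσ : √(1 - Real.exp (-s) ^ 2) ^ α ≤ 2 * s ^ (α / 2) := by
      have h2s : 1 - Real.exp (-s) ^ 2 ≤ 2 * s := by
        rw [← Real.exp_nat_mul]
        have := Real.add_one_le_exp ((2 : ℕ) * -s)
        push_cast at this ⊢
        linarith
      rw [Real.sqrt_eq_rpow, ← Real.rpow_mul (by linarith)]
      refine (Real.rpow_le_rpow (by linarith) h2s (by linarith)).trans ?_
      rw [Real.mul_rpow zero_le_two hs.le, show 1 / 2 * α = α / 2 by ring]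
      refine mul_le_mul_of_nonneg_right ?_ (by positivity)
      have := Real.rpow_le_rpow_of_exponent_le (x := 2) (y := α / 2) (z := 1) (by norm_num)
        (by linarith)
      rwa [Real.rpow_one] at this
    have h2 : |g (Real.exp (-s) • x + √(1 - Real.exp (-s) ^ 2) • z) - g (Real.exp (-s) • x)| ≤
        K * (2 * s ^ (α / 2) * ‖z‖ ^ α) := by
      refine (hHol _ _).trans (mul_le_mul_of_nonneg_left ?_ hK.le)
      rw [add_sub_cancel_left, norm_smul, Real.norm_of_nonneg (Real.sqrt_nonneg _),
        Real.mul_rpow (Real.sqrt_nonneg _) (norm_nonneg _)]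
      exact mul_le_mul_of_nonneg_right hσ (by positivity)
    have h3 := abs_sub_le (g (Real.exp (-s) • x + √(1 - Real.exp (-s) ^ 2) • z))
      (g (Real.exp (-s) • x)) (g x)
    calc _ ≤ Real.exp (-‖z‖ ^ 2) * (K * (2 * s ^ (α / 2) * ‖z‖ ^ α) + K * s ^ (α / 2)) :=
          mul_le_mul_of_nonneg_left (by linarith) (Real.exp_pos _).le
      _ = _ := by ring
  have hint' : Integrable fun z : EuclideanSpace ℝ (Fin n) => Real.exp (-‖z‖ ^ 2) *
      |g (Real.exp (-s) • x + √(1 - Real.exp (-s) ^ 2) • z) - g x| := by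
    refine (hint.const_mul (K * s ^ (α / 2))).mono' (by fun_prop) (Eventually.of_forall fun z => ?_)
    rw [Real.norm_of_nonneg (by positivity)]
    exact hbound z
  refine ⟨(integrable_mehlerKernel_mul_iff hr x fun y => |g y - g x|).2 hint', ?_⟩
  rw [integral_mehlerKernel_mul hr x fun y => |g y - g x|]
  refine (integral_mono hint' (hint.const_mul _) hbound).trans ?_
  rw [integral_const_mul]
  have : 0 ≤ s ^ (α / 2) := by positivity
  linarith

lemma integrable_mehlerKernel {r : ℝ} (hr : r ^ 2 < 1) (x : EuclideanSpace ℝ (Fin n)) :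
    Integrable (mehlerKernel r x) := by
  have h := (integrable_mehlerKernel_mul_iff hr x fun _ => 1).2
    (by simpa using integrable_exp_neg_norm_sq)
  simpa using h

lemma integral_mehlerKernel {r : ℝ} (hr : r ^ 2 < 1) (x : EuclideanSpace ℝ (Fin n)) :
    ∫ y, mehlerKernel r x y = ∫ z : EuclideanSpace ℝ (Fin n), Real.exp (-‖z‖ ^ 2) := by
  simpa using integral_mehlerKernel_mul hr x fun _ => 1

theorem growthCondition_of_lipCondition (hα₀ : 0 < α) (hα₁ : α < 1)
    {g : EuclideanSpace ℝ (Fin n) → ℝ} (hg : LipCondition α g) : GrowthCondition g := by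
  obtain ⟨K, hK, hg⟩ := hg
  have hHol : ∀ x y, |g x - g y| ≤ K * ‖x - y‖ ^ α := fun x y =>
    (hg x y).trans (mul_le_mul_of_nonneg_left (min_le_left _ _) hK.le)
  have hcont : Continuous g := continuous_of_abs_sub_le hα₀ hHol
  refine ((integrable_exp_neg_norm_sq.const_mul |g 0|).add
    ((integrable_exp_neg_norm_sq_mul_rpow hα₀ hα₁).const_mul K)).mono' ?_
    (Eventually.of_forall fun y => ?_)
  · exact Measurable.aestronglyMeasurable (by fun_prop)
  · have h1 : 1 ≤ √(Real.log (Real.exp 1 + ‖y‖)) :=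
      Real.one_le_sqrt.2 (one_le_log_exp_one_add (norm_nonneg y))
    have h2 : |g y| ≤ |g 0| + K * ‖y‖ ^ α := by
      have := hHol y 0
      rw [sub_zero] at this
      linarith [abs_sub_abs_le_abs_sub (g y) (g 0)]
    rw [Real.norm_of_nonneg (by positivity)]
    calc _ ≤ Real.exp (-‖y‖ ^ 2) * |g y| :=
          mul_le_mul_of_nonneg_right (div_le_self (Real.exp_pos _).le h1) (abs_nonneg _)
      _ ≤ Real.exp (-‖y‖ ^ 2) * (|g 0| + K * ‖y‖ ^ α) :=
          mul_le_mul_of_nonneg_left h2 (Real.exp_pos _).le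
      _ = |g 0| * Real.exp (-‖y‖ ^ 2) + K * (Real.exp (-‖y‖ ^ 2) * ‖y‖ ^ α) := by ring

/-! ### The Poisson integral -/

/-- The unnormalized Ornstein-Uhlenbeck semigroup `s ↦ ∫ M_{e^{-s}}(x, y) g(y) dy`. -/
def mehlerIntegral (g : EuclideanSpace ℝ (Fin n) → ℝ) (x : EuclideanSpace ℝ (Fin n)) (s : ℝ) : ℝ :=
  ∫ y, mehlerKernel (Real.exp (-s)) x y * g y

/-- The total mass `∫ e^{-|z|²} dz` of the Mehler kernel. -/
def gaussianMass (n : ℕ) : ℝ := ∫ z : EuclideanSpace ℝ (Fin n), Real.exp (-‖z‖ ^ 2)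

lemma measurable_mehlerIntegral {g : EuclideanSpace ℝ (Fin n) → ℝ} (hg : Measurable g)
    (x : EuclideanSpace ℝ (Fin n)) : Measurable (mehlerIntegral g x) := by
  have h : StronglyMeasurable (Function.uncurry fun (s : ℝ) (y : EuclideanSpace ℝ (Fin n)) =>
      mehlerKernel (Real.exp (-s)) x y * g y) :=
    ((measurable_mehlerKernel x).mul (hg.comp measurable_snd)).stronglyMeasurable
  exact h.integral_prod_right.measurable

section

variable {g : EuclideanSpace ℝ (Fin n) → ℝ} {x : EuclideanSpace ℝ (Fin n)} {C s t : ℝ}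

lemma integrable_mehlerKernel_mul (hg : Measurable g) (hs : 0 < s)
    (hint : Integrable fun y => mehlerKernel (Real.exp (-s)) x y * |g y - g x|) :
    Integrable fun y => mehlerKernel (Real.exp (-s)) x y * g y := by
  have hr := exp_neg_sq_lt_one hs
  have hM : Measurable (mehlerKernel (Real.exp (-s)) x) := by
    unfold mehlerKernel
    fun_prop
  refine (hint.add ((integrable_mehlerKernel hr x).mul_const |g x|)).mono'
    (hM.mul hg).aestronglyMeasurable (Eventually.of_forall fun y => ?_)
  have h0 := mehlerKernel_nonneg hr x y
  have h1 : |g y| ≤ |g y - g x| + |g x| := by linarith [abs_sub_abs_le_abs_sub (g y) (g x)]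
  rw [norm_mul, Real.norm_of_nonneg h0, Real.norm_eq_abs, Pi.add_apply, ← mul_add]
  exact mul_le_mul_of_nonneg_left h1 h0

lemma integral_abs_mehlerKernel_mul_le (hg : Measurable g) (hs : 0 < s)
    (hint : Integrable fun y => mehlerKernel (Real.exp (-s)) x y * |g y - g x|)
    (hle : ∫ y, mehlerKernel (Real.exp (-s)) x y * |g y - g x| ≤ C * s ^ (α / 2)) :
    ∫ y, |mehlerKernel (Real.exp (-s)) x y * g y| ≤ C * s ^ (α / 2) + gaussianMass n * |g x| := by
  have hr := exp_neg_sq_lt_one hs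
  have h2 : ∫ y, |mehlerKernel (Real.exp (-s)) x y * g y| ≤
      ∫ y, (mehlerKernel (Real.exp (-s)) x y * |g y - g x| +
        mehlerKernel (Real.exp (-s)) x y * |g x|) := by
    refine integral_mono (integrable_mehlerKernel_mul hg hs hint).abs
      (hint.add ((integrable_mehlerKernel hr x).mul_const |g x|)) fun y => ?_
    have h0 := mehlerKernel_nonneg hr x y
    have h1 : |g y| ≤ |g y - g x| + |g x| := by linarith [abs_sub_abs_le_abs_sub (g y) (g x)]
    simp only [abs_mul, abs_of_nonneg h0, ← mul_add]
    exact mul_le_mul_of_nonneg_left h1 h0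
  rw [integral_add hint ((integrable_mehlerKernel hr x).mul_const |g x|), integral_mul_const,
    integral_mehlerKernel hr] at h2
  exact h2.trans (add_le_add_left hle _)

lemma abs_mehlerIntegral_sub_le (hg : Measurable g) (hs : 0 < s)
    (hint : Integrable fun y => mehlerKernel (Real.exp (-s)) x y * |g y - g x|)
    (hle : ∫ y, mehlerKernel (Real.exp (-s)) x y * |g y - g x| ≤ C * s ^ (α / 2)) :
    |mehlerIntegral g x s - gaussianMass n * g x| ≤ C * s ^ (α / 2) := by
  have hr := exp_neg_sq_lt_one hs
  have h : mehlerIntegral g x s - gaussianMass n * g x =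
      ∫ y, mehlerKernel (Real.exp (-s)) x y * (g y - g x) := by
    simp only [mul_sub]
    rw [integral_sub (integrable_mehlerKernel_mul hg hs hint)
      ((integrable_mehlerKernel hr x).mul_const _), integral_mul_const, integral_mehlerKernel hr]
    rfl
  rw [h]
  refine abs_integral_le_integral_abs.trans (le_of_eq_of_le ?_ hle)
  refine integral_congr_ae (Eventually.of_forall fun y => ?_)
  simp only [abs_mul, abs_of_nonneg (mehlerKernel_nonneg hr x y)]

-- The only property of `g` used below is the bound of the Gaussian mean of `|g - g(x)|` at the
-- fixed point `x`.
variable (hα₁ : α < 1) (hg : Measurable g)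
  (hint : ∀ s, 0 < s → Integrable fun y => mehlerKernel (Real.exp (-s)) x y * |g y - g x|)
  (hle : ∀ s, 0 < s →
    ∫ y, mehlerKernel (Real.exp (-s)) x y * |g y - g x| ≤ C * s ^ (α / 2))

include hα₁ hg hint hle

lemma integrable_subordDensity_mul_mehlerKernel_mul (ht : 0 < t) :
    Integrable (Function.uncurry fun (s : ℝ) (y : EuclideanSpace ℝ (Fin n)) =>
      subordDensity t s * (mehlerKernel (Real.exp (-s)) x y * g y))
      ((volume.restrict (Set.Ioi 0)).prod volume) := by
  have hmeas : Measurable (Function.uncurry fun (s : ℝ) (y : EuclideanSpace ℝ (Fin n)) =>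
      subordDensity t s * (mehlerKernel (Real.exp (-s)) x y * g y)) :=
    ((measurable_subordDensity t).comp measurable_fst).mul
      ((measurable_mehlerKernel x).mul (hg.comp measurable_snd))
  rw [integrable_prod_iff hmeas.aestronglyMeasurable]
  refine ⟨(ae_restrict_iff' measurableSet_Ioi).2 (Eventually.of_forall fun s hs =>
    (integrable_mehlerKernel_mul hg hs (hint s hs)).const_mul (subordDensity t s)), ?_⟩
  have hdom : IntegrableOn (fun s => C * (s ^ (α / 2) * subordDensity t s) +
      gaussianMass n * |g x| * (s ^ (0 : ℝ) * subordDensity t s)) (Set.Ioi 0) :=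
    ((integrableOn_rpow_mul_subordDensity ht (by linarith)).const_mul _).add
      ((integrableOn_rpow_mul_subordDensity ht (by norm_num)).const_mul _)
  refine hdom.mono' hmeas.norm.stronglyMeasurable.integral_prod_right.aestronglyMeasurable
    ((ae_restrict_iff' measurableSet_Ioi).2 (Eventually.of_forall fun s hs => ?_))
  have hk := subordDensity_nonneg ht.le hs
  rw [Real.norm_of_nonneg (integral_nonneg fun _ => norm_nonneg _)]
  simp only [Function.uncurry_apply_pair, norm_mul (subordDensity t s), Real.norm_of_nonneg hk]
  rw [integral_const_mul, Real.rpow_zero]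
  refine (mul_le_mul_of_nonneg_left (integral_abs_mehlerKernel_mul_le hg hs (hint s hs) (hle s hs))
    hk).trans (le_of_eq ?_)
  ring

lemma integrable_poissonKernel_mul (ht : 0 < t) :
    Integrable fun y => poissonKernel t x y * g y := by
  have h := ((integrable_subordDensity_mul_mehlerKernel_mul hα₁ hg hint hle
    ht).integral_prod_right).const_mul (1 / (2 * Real.pi ^ (((n : ℝ) + 1) / 2)))
  refine h.congr (Eventually.of_forall fun y => ?_)
  simp only [Function.uncurry_apply_pair, ← mul_assoc]
  rw [integral_mul_const, ← mul_assoc]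
  rfl

/-- By Fubini's theorem, the Poisson integral is obtained from the Mehler integrals by
subordination. -/
lemma poissonIntegral_eq (ht : 0 < t) :
    poissonIntegral t g x = 1 / (2 * Real.pi ^ (((n : ℝ) + 1) / 2)) *
      ∫ s in Set.Ioi (0 : ℝ), subordDensity t s * mehlerIntegral g x s := by
  have h := integral_integral_swap
    (integrable_subordDensity_mul_mehlerKernel_mul hα₁ hg hint hle ht)
  simp only [integral_const_mul] at h
  unfold mehlerIntegral
  rw [h, ← integral_const_mul]
  refine integral_congr_ae (Eventually.of_forall fun y => ?_)
  simp only [← mul_assoc]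
  rw [integral_mul_const, ← mul_assoc]
  rfl

/-- Differentiation under the integral sign in the subordination formula. -/
lemma hasDerivAt_poissonIntegral (ht : 0 < t) :
    IntegrableOn (fun s => subordDensityDeriv t s * mehlerIntegral g x s) (Set.Ioi 0) ∧
    HasDerivAt (fun τ => poissonIntegral τ g x) (1 / (2 * Real.pi ^ (((n : ℝ) + 1) / 2)) *
      ∫ s in Set.Ioi (0 : ℝ), subordDensityDeriv t s * mehlerIntegral g x s) t := by
  have hG := measurable_mehlerIntegral hg x
  have hGle : ∀ s, 0 < s →
      |mehlerIntegral g x s| ≤ C * s ^ (α / 2) + gaussianMass n * |g x| * s ^ (0 : ℝ) :=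
    fun s hs => by
      rw [Real.rpow_zero, mul_one]
      exact abs_integral_le_integral_abs.trans
        (integral_abs_mehlerKernel_mul_le hg hs (hint s hs) (hle s hs))
  have hdom := ((integrableOn_rpow_mul_majorant (b := t / 2) (c := α / 2) (B := 2 * t)
    (by linarith) (by linarith)).const_mul C).add
    ((integrableOn_rpow_mul_majorant (b := t / 2) (c := 0) (B := 2 * t)
    (by linarith) (by norm_num)).const_mul (gaussianMass n * |g x|))
  have hmain := hasDerivAt_integral_of_dominated_loc_of_deriv_le
    (μ := volume.restrict (Set.Ioi (0 : ℝ)))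
    (F := fun τ s => subordDensity τ s * mehlerIntegral g x s)
    (F' := fun τ s => subordDensityDeriv τ s * mehlerIntegral g x s)
    (Icc_mem_nhds (by linarith : t / 2 < t) (by linarith : t < 2 * t))
    (Eventually.of_forall fun τ => ((measurable_subordDensity τ).mul hG).aestronglyMeasurable)
    ?_ ((measurable_subordDensityDeriv t).mul hG).aestronglyMeasurable
    ((ae_restrict_iff' measurableSet_Ioi).2 (Eventually.of_forall fun s hs τ hτ => ?_)) hdom
    ((ae_restrict_iff' measurableSet_Ioi).2 (Eventually.of_forall fun s hs τ hτ =>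
      (hasDerivAt_subordDensity hs).mul_const _))
  · refine ⟨hmain.1, (hmain.2.const_mul _).congr_of_eventuallyEq ?_⟩
    filter_upwards [eventually_gt_nhds ht] with τ hτ
    exact poissonIntegral_eq hα₁ hg hint hle hτ
  · have h := (integrable_subordDensity_mul_mehlerKernel_mul hα₁ hg hint hle ht).integral_prod_left
    simpa only [Function.uncurry_apply_pair, integral_const_mul, mehlerIntegral] using h
  · rw [norm_mul, Real.norm_eq_abs, Real.norm_eq_abs]
    refine (mul_le_mul (abs_subordDensityDeriv_le (by linarith) hτ.1 hτ.2 hs) (hGle s hs)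
      (abs_nonneg _) ?_).trans (le_of_eq ?_)
    · have : (0 : ℝ) < s := hs
      positivity
    · simp only [Pi.add_apply]
      ring

/-- Since `∫ ∂_t k_t(s) ds = 0`, the value `g(x)` may be subtracted from the Mehler integrals, which
leaves an integrand of size `s^{α/2} |∂_t k_t(s)|`. -/
lemma abs_deriv_poissonIntegral_le (ht : 0 < t) :
    |t * deriv (fun τ => poissonIntegral τ g x) t| ≤
      1 / (2 * Real.pi ^ (((n : ℝ) + 1) / 2)) * (C * (4 ^ (1 / 2 - α / 2) *
        (Real.Gamma (1 / 2 - α / 2) + 2 * Real.Gamma (3 / 2 - α / 2)))) * t ^ α := by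
  obtain ⟨hi, hd⟩ := hasDerivAt_poissonIntegral hα₁ hg hint hle ht
  have hmaj : ∀ s : ℝ, 0 < s → |subordDensityDeriv t s| ≤
      s ^ (-(1 / 2 : ℝ) - 1) * Real.exp (-(t ^ 2 / 4 / s)) +
        t ^ 2 / 2 * (s ^ (-(3 / 2 : ℝ) - 1) * Real.exp (-(t ^ 2 / 4 / s))) :=
    fun s hs => abs_subordDensityDeriv_le ht.le le_rfl le_rfl hs
  have hk : IntegrableOn (subordDensityDeriv t) (Set.Ioi 0) := by
    refine (integrableOn_rpow_mul_majorant (b := t) (c := 0) (B := t) ht (by norm_num)).mono'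
      (measurable_subordDensityDeriv t).aestronglyMeasurable
      ((ae_restrict_iff' measurableSet_Ioi).2 (Eventually.of_forall fun s hs => ?_))
    simpa only [Real.rpow_zero, one_mul, Real.norm_eq_abs] using hmaj s hs
  have hcancel : ∫ s in Set.Ioi (0 : ℝ), subordDensityDeriv t s * mehlerIntegral g x s =
      ∫ s in Set.Ioi (0 : ℝ),
        subordDensityDeriv t s * (mehlerIntegral g x s - gaussianMass n * g x) := by
    simp only [mul_sub]
    rw [integral_sub hi (hk.mul_const _), integral_mul_const, integral_subordDensityDeriv ht,
      zero_mul, sub_zero]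
  have hbound : |∫ s in Set.Ioi (0 : ℝ), subordDensityDeriv t s * mehlerIntegral g x s| ≤
      C * (4 ^ (1 / 2 - α / 2) * (Real.Gamma (1 / 2 - α / 2) + 2 * Real.Gamma (3 / 2 - α / 2)) *
        t ^ (2 * (α / 2) - 1)) := by
    rw [hcancel, ← integral_rpow_mul_majorant ht (by linarith), ← integral_const_mul,
      ← Real.norm_eq_abs]
    refine norm_integral_le_of_norm_le
      ((integrableOn_rpow_mul_majorant ht (by linarith)).const_mul C)
      ((ae_restrict_iff' measurableSet_Ioi).2 (Eventually.of_forall fun s hs => ?_))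
    rw [norm_mul, Real.norm_eq_abs, Real.norm_eq_abs]
    refine (mul_le_mul (hmaj s hs) (abs_mehlerIntegral_sub_le hg hs (hint s hs) (hle s hs))
      (abs_nonneg _) ?_).trans (le_of_eq (by ring))
    have : (0 : ℝ) < s := hs
    positivity
  have hc : 0 ≤ 1 / (2 * Real.pi ^ (((n : ℝ) + 1) / 2)) := by positivity
  rw [hd.deriv, abs_mul, abs_mul, abs_of_pos ht, abs_of_nonneg hc]
  refine (mul_le_mul_of_nonneg_left (mul_le_mul_of_nonneg_left hbound hc) ht.le).trans
    (le_of_eq ?_)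
  rw [show 2 * (α / 2) - 1 = α - 1 by ring, Real.rpow_sub_one ht.ne']
  field_simp

end

/-- The Lipschitz-type condition implies membership in the global Gaussian Lipschitz space. -/
theorem memGGLip_of_lipCondition (hα₀ : 0 < α) (hα₁ : α < 1)
    {g : EuclideanSpace ℝ (Fin n) → ℝ} (hg : LipCondition α g) : MemGGLip α g := by
  obtain ⟨C, hC, hmehler⟩ := exists_integral_mehlerKernel_mul_abs_sub_le hα₀ hα₁ hg
  have hmeas : Measurable g := by
    obtain ⟨K, hK, hKg⟩ := hg
    exact (continuous_of_abs_sub_le hα₀ fun x y => (hKg x y).trans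
      (mul_le_mul_of_nonneg_left (min_le_left _ _) hK.le)).measurable
  have hint := fun x s (hs : 0 < s) => (hmehler s hs x).1
  have hle := fun x s (hs : 0 < s) => (hmehler s hs x).2
  refine ⟨hmeas.aemeasurable, growthCondition_of_lipCondition hα₀ hα₁ hg,
    1 / (2 * Real.pi ^ (((n : ℝ) + 1) / 2)) * (C * (4 ^ (1 / 2 - α / 2) *
      (Real.Gamma (1 / 2 - α / 2) + 2 * Real.Gamma (3 / 2 - α / 2)))), ?_, fun t ht =>
    ⟨fun x => ⟨integrable_poissonKernel_mul hα₁ hmeas (hint x) (hle x) ht,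
      (hasDerivAt_poissonIntegral hα₁ hmeas (hint x) (hle x) ht).2.differentiableAt⟩, ?_⟩⟩
  · have h1 := Real.Gamma_pos_of_pos (by linarith : 0 < 1 / 2 - α / 2)
    have h2 := Real.Gamma_pos_of_pos (by linarith : 0 < 3 / 2 - α / 2)
    positivity
  · refine (eLpNorm_le_of_ae_bound (Eventually.of_forall fun x =>
      abs_deriv_poissonIntegral_le hα₁ hmeas (hint x) (hle x) ht)).trans (le_of_eq ?_)
    rw [ENNReal.toReal_top, inv_zero, ENNReal.rpow_zero, one_mul]

end GaussLip

end

theorem mainTheorem2 (n : ℕ) (hn : 1 ≤ n) (α : ℝ) (hα₀ : 0 < α) (hα₁ : α < 1) :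
    -- the function `[ln(e + |x|)]^{α/2}` belongs to `GGLip_α`
    GaussLip.MemGGLip α (GaussLip.logExample n α) ∧
    -- it satisfies the Lipschitz-type condition
    GaussLip.LipCondition α (GaussLip.logExample n α) ∧
    -- the Lipschitz-type condition implies the growth bound `O((ln |x|)^{α/2})`
    (∀ g : EuclideanSpace ℝ (Fin n) → ℝ, GaussLip.LipCondition α g →
      g =O[cocompact (EuclideanSpace ℝ (Fin n))] GaussLip.logGrowth n α) ∧
    -- the example grows exactly at this rate
    GaussLip.logExample n α ~[cocompact (EuclideanSpace ℝ (Fin n))] GaussLip.logGrowth n α ∧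
    -- so the bound is sharp: any other bound valid under the condition is at least as large
    (∀ φ : EuclideanSpace ℝ (Fin n) → ℝ,
      (∀ g : EuclideanSpace ℝ (Fin n) → ℝ, GaussLip.LipCondition α g →
        g =O[cocompact (EuclideanSpace ℝ (Fin n))] φ) →
      GaussLip.logGrowth n α =O[cocompact (EuclideanSpace ℝ (Fin n))] φ) := by
  have hLip := GaussLip.lipCondition_logExample (n := n) hα₀ hα₁
  have hequiv := GaussLip.isEquivalent_logExample_logGrowth (n := n) hα₀ hα₁
  exact ⟨GaussLip.memGGLip_of_lipCondition hα₀ hα₁ hLip, hLip,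
    fun g hg => GaussLip.isBigO_logGrowth_of_lipCondition hα₀ hg, hequiv,
    fun φ hφ => hequiv.symm.isBigO.trans (hφ _ hLip)⟩
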